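/- Let $Z_1,Z_2,Z_3\in\mathbb R^2$ be the vertices of an equilateral triangle of side $r>0$, let $d_1,d_2,d_3>0$ with $d_1=d_2$, and let $X$ be the set of all global minimizers over $W\in\mathbb R^2$ of $$O(W)=\sum_{j=1}^3\bigl|\,\|W-Z_j\|^2-d_j^2\,\bigr| .$$ Let $S_j$ be the circle with center $Z_j$ and radius $d_j$. For $\{i,j,k\}=\{1,2,3\}$ let $S_{ij+}$ and $S_{ij-}$ be the points of $S_i\cap S_j$ with the shortest and the longest distance from $Z_k$, respectively (if $|S_i\cap S_j|=1$, both denote its only point). Put $Y_0=\frac13(Z_1+Z_2+Z_3)$ and $Y_3=3Y_0-2Z_3$, and let $N_3$ be the point closest to $Y_3$ in the set $R_{001}=\{W:\ \|W-Z_1\|\ge d_1,\ \|W-Z_2\|\ge d_2,\ \|W-Z_3\|\le d_3\}$. Then $X$ is given by the following table; in each row the points named in the third column exist and are unique. | $d_1=d_2$ | $d_3$ | $X$ | |---|---|---| | $\left(0,\frac r{\sqrt3}\right]$ | $\left(0,\frac r{\sqrt3}\right]$ | $\{Y_0\}$ | | $(0,r]$ | $[\sqrt3\,r,\infty)$ |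 $\{Y_3\}$ | | $\left(0,\frac r2\right]$ | $\left[\frac r{\sqrt3},\sqrt3\,r\right]$ | $\{N_3\}$ | | $\left(\frac r2,\frac r{\sqrt3}\right]$ | $\left[\frac r{\sqrt3},\frac{\sqrt3}2r-\sqrt{d_1^2-\frac{r^2}4}\right]$ | $\{N_3\}$ | | $\left(\frac r2,r\right]$ | $\left[\frac{\sqrt3}2r+\sqrt{d_1^2-\frac{r^2}4},\sqrt3\,r\right]$ | $\{N_3\}$ | | $\left(\frac r2,\frac r{\sqrt3}\right)$ | $\left(\frac{\sqrt3}2r-\sqrt{d_1^2-\frac{r^2}4},\frac{\sqrt3}2r+\sqrt{d_1^2-\frac{r^2}4}\right)$ | $\{S_{23+},S_{31+}\}$ | | $\left[\frac r{\sqrt3},\infty\right)$ | $(0,d_1)$ | $\{S_{12+}\}$ | | $\left[\frac r{\sqrt3},\infty\right)$ | $d_3=d_1$ | $\{S_{12+},S_{23+},S_{31+}\}$ | | $\left[\frac r{\sqrt3},r\right)$ | $\left(d_1,\frac{\sqrt3}2r+\sqrt{d_1^2-\frac{r^2}4}\right)$ | $\{S_{23+},S_{31+}\}$ | | $[r,\infty)$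 | $\left(d_1,\sqrt{d_1^2+2r^2}\right)$ | $\{S_{23+},S_{31+}\}$ | | $[r,\infty)$ | $d_3=\sqrt{d_1^2+2r^2}$ | $\{S_{23+},S_{31+},S_{12-}\}$ | | $[r,\infty)$ | $\left(\sqrt{d_1^2+2r^2},\infty\right)$ | $\{S_{12-}\}$ | (Points listed in one row may coincide in boundary cases.) -/

import Mathlib

namespace SourceLoc

/-- The Euclidean plane. -/
abbrev Plane := EuclideanSpace ℝ (Fin 2)

/-- The objective function `O(W) = ∑ j, | ‖W - Z_j‖² - d_j² |`. The sensors `Z_1, Z_2, Z_3` are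
`Z 0, Z 1, Z 2` and the measurements `d_1, d_2, d_3` are `d 0, d 1, d 2`. -/
noncomputable def objective (Z : Fin 3 → Plane) (d : Fin 3 → ℝ) (W : Plane) : ℝ :=
  ∑ j, |‖W - Z j‖ ^ 2 - d j ^ 2|

/-- The solution set `X`: all global minimizers of the objective function over the plane. -/
def sources (Z : Fin 3 → Plane) (d : Fin 3 → ℝ) : Set Plane :=
  {W | ∀ V, objective Z d W ≤ objective Z d V}

/-- The intersection `S_i ∩ S_j` of two measurement circles. -/
def circleInter (Z : Fin 3 → Plane) (d : Fin 3 → ℝ) (i j : Fin 3) : Set Plane :=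
  Metric.sphere (Z i) (d i) ∩ Metric.sphere (Z j) (d j)

/-- `P` is the unique point of `A` with the shortest distance from `C`. -/
def IsNearestPoint (A : Set Plane) (C P : Plane) : Prop :=
  P ∈ A ∧ ∀ Q ∈ A, Q ≠ P → dist P C < dist Q C

/-- `P` is the unique point of `A` with the longest distance from `C`. -/
def IsFarthestPoint (A : Set Plane) (C P : Plane) : Prop :=
  P ∈ A ∧ ∀ Q ∈ A, Q ≠ P → dist Q C < dist P C

/-- `P = S_{ij+}`, where `k` is the index of the third sensor: the point of `S_i ∩ S_j` closest to
`Z_k`, which is the only point of `S_i ∩ S_j` if there is just one. -/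
def IsSPlus (Z : Fin 3 → Plane) (d : Fin 3 → ℝ) (i j k : Fin 3) (P : Plane) : Prop :=
  IsNearestPoint (circleInter Z d i j) (Z k) P

/-- `P = S_{ij-}`, where `k` is the index of the third sensor: the point of `S_i ∩ S_j` farthest
from `Z_k`, which is the only point of `S_i ∩ S_j` if there is just one. -/
def IsSMinus (Z : Fin 3 → Plane) (d : Fin 3 → ℝ) (i j k : Fin 3) (P : Plane) : Prop :=
  IsFarthestPoint (circleInter Z d i j) (Z k) P

/-- The region `R_{001}`: the part of the closed third disk outside the open first and second
disks. -/
def region001 (Z : Fin 3 → Plane) (d : Fin 3 → ℝ) : Set Plane :=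
  Metric.closedBall (Z 2) (d 2) \ (Metric.ball (Z 0) (d 0) ∪ Metric.ball (Z 1) (d 1))

/-- The barycenter `Y_0 = (Z_1 + Z_2 + Z_3) / 3`. -/
noncomputable def Y0 (Z : Fin 3 → Plane) : Plane := (1 / 3 : ℝ) • ∑ i, Z i

/-- `Y_3 = 3 Y_0 - 2 Z_3`. -/
noncomputable def Y3 (Z : Fin 3 → Plane) : Plane := (3 : ℝ) • Y0 Z - (2 : ℝ) • Z 2

/-- `P = N_3`: the point of `R_{001}` closest to `Y_3`. -/
def IsN3 (Z : Fin 3 → Plane) (d : Fin 3 → ℝ) (P : Plane) : Prop :=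
  IsNearestPoint (region001 Z d) (Y3 Z) P

/-- `X = {Y_0}`. -/
def SolY0 (Z : Fin 3 → Plane) (d : Fin 3 → ℝ) : Prop := sources Z d = {Y0 Z}

/-- `X = {Y_3}`. -/
def SolY3 (Z : Fin 3 → Plane) (d : Fin 3 → ℝ) : Prop := sources Z d = {Y3 Z}

/-- `N_3` exists and `X = {N_3}`. -/
def SolN3 (Z : Fin 3 → Plane) (d : Fin 3 → ℝ) : Prop :=
  ∃ N, IsN3 Z d N ∧ sources Z d = {N}

/-- `S_{12+}` exists and `X = {S_{12+}}`. -/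
def SolS12p (Z : Fin 3 → Plane) (d : Fin 3 → ℝ) : Prop :=
  ∃ A, IsSPlus Z d 0 1 2 A ∧ sources Z d = {A}

/-- `S_{12-}` exists and `X = {S_{12-}}`. -/
def SolS12m (Z : Fin 3 → Plane) (d : Fin 3 → ℝ) : Prop :=
  ∃ A, IsSMinus Z d 0 1 2 A ∧ sources Z d = {A}

/-- `S_{23+}, S_{31+}` exist and `X = {S_{23+}, S_{31+}}`. -/
def SolS23pS31p (Z : Fin 3 → Plane) (d : Fin 3 → ℝ) : Prop :=
  ∃ B C, IsSPlus Z d 1 2 0 B ∧ IsSPlus Z d 2 0 1 C ∧ sources Z d = {B, C}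

/-- `S_{12+}, S_{23+}, S_{31+}` exist and `X = S_{123+} = {S_{12+}, S_{23+}, S_{31+}}`. -/
def SolS123p (Z : Fin 3 → Plane) (d : Fin 3 → ℝ) : Prop :=
  ∃ A B C, IsSPlus Z d 0 1 2 A ∧ IsSPlus Z d 1 2 0 B ∧ IsSPlus Z d 2 0 1 C ∧
    sources Z d = {A, B, C}

/-- `S_{23+}, S_{31+}, S_{12-}` exist and `X = {S_{23+}, S_{31+}, S_{12-}}`. -/
def SolS23pS31pS12m (Z : Fin 3 → Plane) (d : Fin 3 → ℝ) : Prop :=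
  ∃ B C A, IsSPlus Z d 1 2 0 B ∧ IsSPlus Z d 2 0 1 C ∧ IsSMinus Z d 0 1 2 A ∧
    sources Z d = {B, C, A}

end SourceLoc

namespace SourceLoc

/-- The objective function in the coordinates of an equilateral frame, with unit of area
`r² / 12`. -/
def cost (D E x y : ℝ) : ℝ :=
  |3 * (x + 1) ^ 2 + y ^ 2 - D ^ 2| + |3 * (x - 1) ^ 2 + y ^ 2 - D ^ 2| +
    |3 * x ^ 2 + (y - 3) ^ 2 - E ^ 2|

theorem mul_le_abs_of_abs_le_one {l t : ℝ} (h₁ : -1 ≤ l) (h₂ : l ≤ 1) : l * t ≤ |t| := by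
  rcases abs_cases t with ⟨h, _⟩ | ⟨h, _⟩ <;> rw [h] <;> nlinarith

/-- The Lagrangian lower bound for the objective function with multipliers `l, l, k`. -/
theorem lagrangian_le_cost {D E l k : ℝ} (hl₁ : -1 ≤ l) (hl₂ : l ≤ 1) (hk₁ : -1 ≤ k)
    (hk₂ : k ≤ 1) (x y : ℝ) :
    2 * l * (3 * x ^ 2 + y ^ 2 + 3 - D ^ 2) + k * (3 * x ^ 2 + (y - 3) ^ 2 - E ^ 2) ≤
      cost D E x y := by
  have h₁ := mul_le_abs_of_abs_le_one (t := 3 * (x + 1) ^ 2 + y ^ 2 - D ^ 2) hl₁ hl₂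
  have h₂ := mul_le_abs_of_abs_le_one (t := 3 * (x - 1) ^ 2 + y ^ 2 - D ^ 2) hl₁ hl₂
  have h₃ := mul_le_abs_of_abs_le_one (t := 3 * x ^ 2 + (y - 3) ^ 2 - E ^ 2) hk₁ hk₂
  unfold cost
  linarith

/-- A point `(0, y₀)` at which a strictly convex Lagrangian is stationary is the only minimizer. -/
theorem eq_of_cost_le_of_stationary {D E l k y₀ c : ℝ} (hl₁ : -1 ≤ l) (hl₂ : l ≤ 1)
    (hk₁ : -1 ≤ k) (hk₂ : k ≤ 1) (hpos : 0 < 2 * l + k)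
    (hstat : 2 * l * y₀ + k * (y₀ - 3) = 0)
    (hc : c = 2 * l * (y₀ ^ 2 + 3 - D ^ 2) + k * ((y₀ - 3) ^ 2 - E ^ 2))
    {x y : ℝ} (h : cost D E x y ≤ c) : x = 0 ∧ y = y₀ := by
  have h₁ := lagrangian_le_cost (D := D) (E := E) hl₁ hl₂ hk₁ hk₂ x y
  have h₂ : (2 * l + k) * (3 * x ^ 2 + (y - y₀) ^ 2) ≤ 0 := by
    have : (2 * l + k) * (3 * x ^ 2 + (y - y₀) ^ 2) =
        2 * l * (3 * x ^ 2 + y ^ 2 + 3 - D ^ 2) + k * (3 * x ^ 2 + (y - 3) ^ 2 - E ^ 2) - c := by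
      rw [hc]; linear_combination -2 * (y - y₀) * hstat
    linarith
  have h₃ : 3 * x ^ 2 + (y - y₀) ^ 2 ≤ 0 := by
    by_contra hn
    have := mul_pos hpos (not_le.1 hn)
    linarith
  constructor
  · exact pow_eq_zero_iff two_ne_zero |>.1 (by nlinarith [sq_nonneg x, sq_nonneg (y - y₀)])
  · have : (y - y₀) ^ 2 = 0 := by nlinarith [sq_nonneg x, sq_nonneg (y - y₀)]
    linarith [pow_eq_zero_iff two_ne_zero |>.1 this]

/-- A sublevel set of the objective function lies in the intersection of a paraboloid with a
tetrahedron; concavity on the tetrahedron bounds the barycentric combination of the values of the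
defect of the paraboloid at the four vertices. -/
theorem tetrahedron_bound {x y u K T w : ℝ} (hu : 3 * u = 3 * x ^ 2 + y ^ 2 - K)
    (h : |u + 2 * x| + |u - 2 * x| + |u + 2 * (T - y)| ≤ 2 * w) :
    ∃ m s, y = T + u / 2 + s ∧ 0 ≤ m ∧ m ≤ w ∧ 0 ≤ m - u ∧ 0 ≤ m + u ∧ 0 ≤ w - m + s ∧
      0 ≤ w - m - s ∧ 0 ≤ m ^ 2 / 4 - x ^ 2 ∧
      (m - u) * (K - 3 * w - 3 * w ^ 2 / 4 - (T - w / 2) ^ 2) +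
      (m + u) * (K + 3 * w - 3 * w ^ 2 / 4 - (T + w / 2) ^ 2) +
      (w - m + s) * (K - (T + w) ^ 2) + (w - m - s) * (K - (T - w) ^ 2) +
      w * (m * (w - m)) + w * (m ^ 2 / 4 - x ^ 2) ≤ 0 := by
  have a₁ := le_abs_self (u + 2 * x)
  have a₂ := neg_le_abs (u + 2 * x)
  have a₃ := le_abs_self (u - 2 * x)
  have a₄ := neg_le_abs (u - 2 * x)
  have a₅ := le_abs_self (u + 2 * (T - y))
  have a₆ := neg_le_abs (u + 2 * (T - y))
  obtain ⟨m, hm⟩ : ∃ m, m = (|u + 2 * x| + |u - 2 * x|) / 2 := ⟨_, rfl⟩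
  obtain ⟨s, hs⟩ : ∃ s, s = y - T - u / 2 := ⟨_, rfl⟩
  have b₁ : 0 ≤ m - u := by linarith
  have b₂ : 0 ≤ m + u := by linarith
  have b₃ : 0 ≤ w - m + s := by linarith
  have b₄ : 0 ≤ w - m - s := by linarith
  have b₅ : 0 ≤ m := by linarith
  have b₆ : 0 ≤ w - m := by linarith
  have b₇ : 0 ≤ m ^ 2 / 4 - x ^ 2 := by
    have := mul_nonneg (show 0 ≤ m - 2 * x by linarith) (show 0 ≤ m + 2 * x by linarith)
    linarith
  refine ⟨m, s, by linarith, b₅, by linarith, b₁, b₂, b₃, b₄, b₇, ?_⟩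
  have hw : 0 ≤ w := by linarith
  have hz : 0 ≤ (w - m / 2) ^ 2 - (u / 2 + s) ^ 2 := by
    have := mul_nonneg (show 0 ≤ w - m / 2 - (u / 2 + s) by linarith)
      (show 0 ≤ w - m / 2 + (u / 2 + s) by linarith)
    linarith
  have hy : y = T + u / 2 + s := by linarith
  subst hy
  have c₁ := mul_nonneg hw hz
  have c₂ := mul_nonneg hw (mul_nonneg b₅ b₆)
  have c₃ := mul_nonneg hw b₇
  have hK : K = 3 * x ^ 2 + (T + u / 2 + s) ^ 2 - 3 * u := by linarith
  subst hK
  nlinarith [c₁, c₂, c₃]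

theorem pair_of_le {x y u K T w : ℝ} (hu : 3 * u = 3 * x ^ 2 + y ^ 2 - K)
    (hw : w ^ 2 + (3 - T) * w = K - T ^ 2) (hT₁ : -3 ≤ T) (hT₂ : T ≤ 1)
    (h : |u + 2 * x| + |u - 2 * x| + |u + 2 * (T - y)| ≤ 2 * w) :
    (x ^ 2 = w ^ 2 / 4 ∧ y = T - w / 2) ∨ (T = 1 ∧ x = 0 ∧ y = T + w) ∨
      (T = -3 ∧ x = 0 ∧ y = T - w) := by
  obtain ⟨m, s, hy, b₀, b₁, b₂, b₃, b₄, b₅, b₆, hb⟩ := tetrahedron_bound hu h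
  rcases (b₀.trans b₁).eq_or_lt with h0 | h0
  · subst h0
    have hm : m = 0 := le_antisymm b₁ b₀
    subst hm
    left
    constructor
    · nlinarith [sq_nonneg x]
    · linarith
  have e₁ : K - 3 * w - 3 * w ^ 2 / 4 - (T - w / 2) ^ 2 = 0 := by linarith
  have e₂ : K + 3 * w - 3 * w ^ 2 / 4 - (T + w / 2) ^ 2 = 2 * w * (3 - T) := by linarith
  have e₃ : K - (T + w) ^ 2 = 3 * w * (1 - T) := by linarith
  have e₄ : K - (T - w) ^ 2 = w * (3 + T) := by linarith
  rw [e₁, e₂, e₃, e₄] at hb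
  have f₂ : 0 < 2 * w * (3 - T) := by have : 0 < 3 - T := by linarith
                                      positivity
  have f₃ : 0 ≤ 3 * w * (1 - T) := by have : 0 ≤ 1 - T := by linarith
                                      positivity
  have f₄ : 0 ≤ w * (3 + T) := by have : 0 ≤ 3 + T := by linarith
                                  positivity
  have g₂ := mul_nonneg b₃ f₂.le
  have g₃ := mul_nonneg b₄ f₃
  have g₄ := mul_nonneg b₅ f₄
  have g₅ := mul_nonneg h0.le (mul_nonneg b₀ (sub_nonneg.2 b₁))
  have g₆ := mul_nonneg h0.le b₆
  have k₂ : m + u = 0 := by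
    have : (m + u) * (2 * w * (3 - T)) = 0 := by linarith
    simpa [f₂.ne'] using this
  have k₃ : (w - m + s) * (3 * w * (1 - T)) = 0 := by linarith
  have k₄ : (w - m - s) * (w * (3 + T)) = 0 := by linarith
  have k₅ : m * (w - m) = 0 := by
    have : w * (m * (w - m)) = 0 := by linarith
    exact (mul_eq_zero.1 this).resolve_left h0.ne'
  have k₆ : m ^ 2 / 4 - x ^ 2 = 0 := by
    have : w * (m ^ 2 / 4 - x ^ 2) = 0 := by linarith
    exact (mul_eq_zero.1 this).resolve_left h0.ne'
  rcases mul_eq_zero.1 k₅ with hm | hm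
  · subst hm
    have hx : x = 0 := pow_eq_zero_iff two_ne_zero |>.1 (by linarith)
    right
    rcases mul_eq_zero.1 k₃ with h₃ | h₃
    · rcases mul_eq_zero.1 k₄ with h₄ | h₄
      · linarith
      · have : 3 + T = 0 := (mul_eq_zero.1 h₄).resolve_left h0.ne'
        exact Or.inr ⟨by linarith, hx, by linarith⟩
    · have : 1 - T = 0 := (mul_eq_zero.1 h₃).resolve_left (by positivity)
      rcases mul_eq_zero.1 k₄ with h₄ | h₄
      · exact Or.inl ⟨by linarith, hx, by linarith⟩
      · have : 3 + T = 0 := (mul_eq_zero.1 h₄).resolve_left h0.ne'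
        linarith
  · have hm' : m = w := by linarith
    subst hm'
    left
    exact ⟨by linarith, by linarith⟩

theorem top_of_le {x y u H T : ℝ} (hu : 3 * u = 3 * x ^ 2 + y ^ 2 - H ^ 2) (hT : 1 < T)
    (hH : T < H) (h : |u + 2 * x| + |u - 2 * x| + |u + 2 * (T - y)| ≤ 2 * (H - T)) :
    x = 0 ∧ y = H := by
  obtain ⟨m, s, hy, b₀, b₁, b₂, b₃, b₄, b₅, b₆, hb⟩ := tetrahedron_bound hu h
  obtain ⟨w, rfl⟩ : ∃ w, H = T + w := ⟨H - T, by ring⟩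
  have h0 : 0 < w := by linarith
  rw [add_sub_cancel_left] at *
  have g₁ := mul_nonneg b₂ (mul_nonneg h0.le (show 0 ≤ 3 * (T - 1) by linarith))
  have g₂ := mul_nonneg b₃ (mul_nonneg h0.le (show 0 ≤ T + 3 by linarith))
  have g₄ := mul_nonneg b₅ (mul_nonneg h0.le (show 0 ≤ 4 * T by linarith))
  have g₅ := mul_nonneg h0.le (mul_nonneg b₀ (sub_nonneg.2 b₁))
  have g₆ := mul_nonneg h0.le b₆
  have k₁ : m - u = 0 := by
    have : (m - u) * (w * (3 * (T - 1))) = 0 := by nlinarith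
    exact (mul_eq_zero.1 this).resolve_right (mul_pos h0 (by linarith)).ne'
  have k₂ : m + u = 0 := by
    have : (m + u) * (w * (T + 3)) = 0 := by nlinarith
    exact (mul_eq_zero.1 this).resolve_right (mul_pos h0 (by linarith)).ne'
  have k₄ : w - m - s = 0 := by
    have : (w - m - s) * (w * (4 * T)) = 0 := by nlinarith
    exact (mul_eq_zero.1 this).resolve_right (mul_pos h0 (by linarith)).ne'
  have hm : m = 0 := by linarith
  subst hm
  exact ⟨pow_eq_zero_iff two_ne_zero |>.1 (by nlinarith [sq_nonneg x]), by linarith⟩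

theorem bottom_of_le {x y u H T : ℝ} (hu : 3 * u = 3 * x ^ 2 + y ^ 2 - H ^ 2) (hT : T < -3)
    (hH : -H < T) (h : |u + 2 * x| + |u - 2 * x| + |u + 2 * (T - y)| ≤ 2 * (H + T)) :
    x = 0 ∧ y = -H := by
  obtain ⟨m, s, hy, b₀, b₁, b₂, b₃, b₄, b₅, b₆, hb⟩ := tetrahedron_bound hu h
  obtain ⟨w, rfl⟩ : ∃ w, H = w - T := ⟨H + T, by ring⟩
  have h0 : 0 < w := by linarith
  rw [sub_add_cancel] at *
  have g₁ := mul_nonneg b₂ (mul_nonneg h0.le (show 0 ≤ -T - 3 by linarith))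
  have g₂ := mul_nonneg b₃ (mul_nonneg h0.le (show 0 ≤ 3 - 3 * T by linarith))
  have g₄ := mul_nonneg b₄ (mul_nonneg h0.le (show 0 ≤ -4 * T by linarith))
  have g₅ := mul_nonneg h0.le (mul_nonneg b₀ (sub_nonneg.2 b₁))
  have g₆ := mul_nonneg h0.le b₆
  have k₁ : m - u = 0 := by
    have : (m - u) * (w * (-T - 3)) = 0 := by nlinarith
    exact (mul_eq_zero.1 this).resolve_right (mul_pos h0 (by linarith)).ne'
  have k₂ : m + u = 0 := by
    have : (m + u) * (w * (3 - 3 * T)) = 0 := by nlinarith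
    exact (mul_eq_zero.1 this).resolve_right (mul_pos h0 (by linarith)).ne'
  have k₄ : w - m + s = 0 := by
    have : (w - m + s) * (w * (-4 * T)) = 0 := by nlinarith
    exact (mul_eq_zero.1 this).resolve_right (mul_pos h0 (by linarith)).ne'
  have hm : m = 0 := by linarith
  subst hm
  exact ⟨pow_eq_zero_iff two_ne_zero |>.1 (by nlinarith [sq_nonneg x]), by linarith⟩


/-- The point with coordinates `x, y` in the frame whose origin is the midpoint of `Z_1` and `Z_2`,
in which `Z_1, Z_2, Z_3` have the coordinates `(-1, 0), (1, 0), (0, 3)`. -/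
noncomputable def framePt (Z : Fin 3 → Plane) (x y : ℝ) : Plane :=
  (1 / 2 : ℝ) • (Z 0 + Z 1) + (x / 2) • (Z 1 - Z 0) + (y / 3) • (Z 2 - (1 / 2 : ℝ) • (Z 0 + Z 1))

theorem framePt_neg_one_zero (Z : Fin 3 → Plane) : framePt Z (-1) 0 = Z 0 := by
  unfold framePt; module

theorem framePt_one_zero (Z : Fin 3 → Plane) : framePt Z 1 0 = Z 1 := by
  unfold framePt; module

theorem framePt_zero_three (Z : Fin 3 → Plane) : framePt Z 0 3 = Z 2 := by
  unfold framePt; module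

theorem framePt_zero_one (Z : Fin 3 → Plane) : framePt Z 0 1 = Y0 Z := by
  unfold framePt Y0; rw [Fin.sum_univ_three]; module

theorem framePt_zero_neg_three (Z : Fin 3 → Plane) : framePt Z 0 (-3) = Y3 Z := by
  unfold framePt Y3 Y0; rw [Fin.sum_univ_three]; module

theorem dist_sq_eq_coords (V W : Plane) : dist V W ^ 2 = (V 0 - W 0) ^ 2 + (V 1 - W 1) ^ 2 := by
  rw [EuclideanSpace.dist_eq, Real.sq_sqrt (by positivity), Fin.sum_univ_two, Real.dist_eq,
    Real.dist_eq, sq_abs, sq_abs]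

/-- Equilateral sensors of side `2√3 b`, with measurements `b D, b D, b E`. -/
structure IsEquilateral (Z : Fin 3 → Plane) (d : Fin 3 → ℝ) (b D E : ℝ) : Prop where
  b_pos : 0 < b
  D_pos : 0 < D
  E_pos : 0 < E
  d_zero : d 0 = b * D
  d_one : d 1 = b * D
  d_two : d 2 = b * E
  dist_sq : ∀ x y x' y', dist (framePt Z x y) (framePt Z x' y') ^ 2 =
    b ^ 2 * (3 * (x - x') ^ 2 + (y - y') ^ 2)
  surj : ∀ W, ∃ x y, W = framePt Z x y

theorem dist_sq_framePt {Z : Fin 3 → Plane} {b : ℝ}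
    (h₁ : dist (Z 0) (Z 1) ^ 2 = 12 * b ^ 2) (h₂ : dist (Z 1) (Z 2) ^ 2 = 12 * b ^ 2)
    (h₃ : dist (Z 2) (Z 0) ^ 2 = 12 * b ^ 2) (x y x' y' : ℝ) :
    dist (framePt Z x y) (framePt Z x' y') ^ 2 =
      b ^ 2 * (3 * (x - x') ^ 2 + (y - y') ^ 2) := by
  rw [dist_sq_eq_coords] at *
  simp only [framePt, PiLp.add_apply, PiLp.smul_apply, PiLp.sub_apply, smul_eq_mul]
  linear_combination ((x - x') ^ 2 / 4 - (y - y') ^ 2 / 36) * h₁ +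
    ((y - y') ^ 2 / 18 - (x - x') * (y - y') / 6) * h₂ +
    ((y - y') ^ 2 / 18 + (x - x') * (y - y') / 6) * h₃

theorem exists_eq_framePt {Z : Fin 3 → Plane} {b : ℝ} (hb : 0 < b)
    (h₁ : dist (Z 0) (Z 1) ^ 2 = 12 * b ^ 2) (h₂ : dist (Z 1) (Z 2) ^ 2 = 12 * b ^ 2)
    (h₃ : dist (Z 2) (Z 0) ^ 2 = 12 * b ^ 2) (W : Plane) : ∃ x y, W = framePt Z x y := by
  rw [dist_sq_eq_coords] at *
  obtain ⟨e, he⟩ : ∃ e, e = (Z 1 0 - Z 0 0) * (Z 2 1 - Z 0 1) - (Z 1 1 - Z 0 1) * (Z 2 0 - Z 0 0) :=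
    ⟨_, rfl⟩
  have he₀ : e ≠ 0 := by
    rintro rfl
    have h : ((Z 1 0 - Z 0 0) * (Z 2 0 - Z 0 0) + (Z 1 1 - Z 0 1) * (Z 2 1 - Z 0 1)) =
        6 * b ^ 2 := by linear_combination (h₁ - h₂ + h₃) / 2
    have h' : (0 : ℝ) ^ 2 = 108 * b ^ 4 := by
      rw [he]
      have : ((Z 1 0 - Z 0 0) * (Z 2 1 - Z 0 1) - (Z 1 1 - Z 0 1) * (Z 2 0 - Z 0 0)) ^ 2 =
        ((Z 0 0 - Z 1 0) ^ 2 + (Z 0 1 - Z 1 1) ^ 2) * ((Z 2 0 - Z 0 0) ^ 2 + (Z 2 1 - Z 0 1) ^ 2) -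
        ((Z 1 0 - Z 0 0) * (Z 2 0 - Z 0 0) + (Z 1 1 - Z 0 1) * (Z 2 1 - Z 0 1)) ^ 2 := by ring
      rw [this, h, h₁, h₃]
      ring
    have : 0 < 108 * b ^ 4 := by positivity
    linarith
  refine ⟨2 * ((W 0 - (Z 0 0 + Z 1 0) / 2) * (Z 2 1 - (Z 0 1 + Z 1 1) / 2) -
      (W 1 - (Z 0 1 + Z 1 1) / 2) * (Z 2 0 - (Z 0 0 + Z 1 0) / 2)) / e,
    3 * ((Z 1 0 - Z 0 0) * (W 1 - (Z 0 1 + Z 1 1) / 2) -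
      (Z 1 1 - Z 0 1) * (W 0 - (Z 0 0 + Z 1 0) / 2)) / e, ?_⟩
  ext i
  fin_cases i
  · simp only [framePt, PiLp.add_apply, PiLp.smul_apply, PiLp.sub_apply, smul_eq_mul,
      Fin.zero_eta]
    field_simp
    rw [he]
    ring
  · simp only [framePt, PiLp.add_apply, PiLp.smul_apply, PiLp.sub_apply, smul_eq_mul,
      Fin.mk_one]
    field_simp
    rw [he]
    ring

namespace IsEquilateral

variable {Z : Fin 3 → Plane} {d : Fin 3 → ℝ} {b D E : ℝ}

theorem objective_framePt (h : IsEquilateral Z d b D E) (x y : ℝ) :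
    objective Z d (framePt Z x y) = b ^ 2 * cost D E x y := by
  have e₁ := h.dist_sq x y (-1) 0
  have e₂ := h.dist_sq x y 1 0
  have e₃ := h.dist_sq x y 0 3
  rw [framePt_neg_one_zero] at e₁
  rw [framePt_one_zero] at e₂
  rw [framePt_zero_three] at e₃
  rw [objective, Fin.sum_univ_three, ← dist_eq_norm, ← dist_eq_norm, ← dist_eq_norm, e₁, e₂, e₃,
    h.d_zero, h.d_one, h.d_two, cost, mul_pow, mul_pow, ← mul_sub, ← mul_sub, ← mul_sub, abs_mul,
    abs_mul, abs_mul, abs_of_pos (pow_pos h.b_pos 2)]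
  simp only [sub_neg_eq_add, sub_zero]
  ring

/-- A nonempty set of coordinates which all have cost `c`, and which contains all coordinates of
cost at most `c`, describes the solution set. -/
theorem sources_eq (h : IsEquilateral Z d b D E) {s : Set (ℝ × ℝ)} {c : ℝ} (hs : s.Nonempty)
    (hc : ∀ p ∈ s, cost D E p.1 p.2 = c) (hmin : ∀ x y, cost D E x y ≤ c → (x, y) ∈ s) :
    sources Z d = (fun p => framePt Z p.1 p.2) '' s := by
  have hb := pow_pos h.b_pos 2
  have hle : ∀ x y, c ≤ cost D E x y := by
    intro x y
    by_contra! hlt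
    exact hlt.ne (hc (x, y) (hmin x y hlt.le))
  ext W
  obtain ⟨x, y, rfl⟩ := h.surj W
  constructor
  · intro hW
    obtain ⟨p, hp⟩ := hs
    have := hW (framePt Z p.1 p.2)
    rw [h.objective_framePt, h.objective_framePt, hc p hp] at this
    exact ⟨(x, y), hmin x y (le_of_mul_le_mul_left this hb), rfl⟩
  · rintro ⟨p, hp, hpe⟩ V
    obtain ⟨x', y', rfl⟩ := h.surj V
    rw [← hpe]
    dsimp only
    rw [h.objective_framePt, h.objective_framePt, hc p hp]
    exact mul_le_mul_of_nonneg_left (hle _ _) hb.le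

theorem sources_eq_singleton (h : IsEquilateral Z d b D E) {x₀ y₀ : ℝ}
    (hmin : ∀ x y, cost D E x y ≤ cost D E x₀ y₀ → x = x₀ ∧ y = y₀) :
    sources Z d = {framePt Z x₀ y₀} := by
  rw [h.sources_eq (s := {(x₀, y₀)}) (c := cost D E x₀ y₀) (Set.singleton_nonempty _)
    (by rintro p rfl; rfl) (fun x y hxy => Prod.ext_iff.2 (hmin x y hxy)), Set.image_singleton]

theorem dist_lt_dist_iff (h : IsEquilateral Z d b D E) {x y x' y' x₀ y₀ : ℝ} :
    dist (framePt Z x y) (framePt Z x₀ y₀) < dist (framePt Z x' y') (framePt Z x₀ y₀) ↔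
      3 * (x - x₀) ^ 2 + (y - y₀) ^ 2 < 3 * (x' - x₀) ^ 2 + (y' - y₀) ^ 2 := by
  rw [← pow_lt_pow_iff_left₀ dist_nonneg dist_nonneg two_ne_zero, h.dist_sq, h.dist_sq,
    mul_lt_mul_iff_right₀ (pow_pos h.b_pos 2)]

theorem dist_le_iff (h : IsEquilateral Z d b D E) {x y x₀ y₀ R : ℝ} (hR : 0 ≤ R) :
    dist (framePt Z x y) (framePt Z x₀ y₀) ≤ b * R ↔
      3 * (x - x₀) ^ 2 + (y - y₀) ^ 2 ≤ R ^ 2 := by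
  rw [← pow_le_pow_iff_left₀ dist_nonneg (mul_nonneg h.b_pos.le hR) two_ne_zero, h.dist_sq,
    mul_pow, mul_le_mul_iff_right₀ (pow_pos h.b_pos 2)]

theorem dist_eq_iff (h : IsEquilateral Z d b D E) {x y x₀ y₀ R : ℝ} (hR : 0 ≤ R) :
    dist (framePt Z x y) (framePt Z x₀ y₀) = b * R ↔
      3 * (x - x₀) ^ 2 + (y - y₀) ^ 2 = R ^ 2 := by
  rw [← pow_left_inj₀ dist_nonneg (mul_nonneg h.b_pos.le hR) two_ne_zero, h.dist_sq,
    mul_pow, mul_right_inj' (pow_pos h.b_pos 2).ne']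

theorem dist_lt_iff (h : IsEquilateral Z d b D E) {x y x₀ y₀ R : ℝ} (hR : 0 ≤ R) :
    dist (framePt Z x y) (framePt Z x₀ y₀) < b * R ↔
      3 * (x - x₀) ^ 2 + (y - y₀) ^ 2 < R ^ 2 := by
  rw [← pow_lt_pow_iff_left₀ dist_nonneg (mul_nonneg h.b_pos.le hR) two_ne_zero, h.dist_sq,
    mul_pow, mul_lt_mul_iff_right₀ (pow_pos h.b_pos 2)]

theorem mem_sphere_zero_iff (h : IsEquilateral Z d b D E) {x y : ℝ} :
    framePt Z x y ∈ Metric.sphere (Z 0) (d 0) ↔ 3 * (x + 1) ^ 2 + y ^ 2 = D ^ 2 := by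
  rw [Metric.mem_sphere, ← framePt_neg_one_zero Z, h.d_zero, h.dist_eq_iff h.D_pos.le]
  simp

theorem mem_sphere_one_iff (h : IsEquilateral Z d b D E) {x y : ℝ} :
    framePt Z x y ∈ Metric.sphere (Z 1) (d 1) ↔ 3 * (x - 1) ^ 2 + y ^ 2 = D ^ 2 := by
  rw [Metric.mem_sphere, ← framePt_one_zero Z, h.d_one, h.dist_eq_iff h.D_pos.le]
  simp

theorem mem_sphere_two_iff (h : IsEquilateral Z d b D E) {x y : ℝ} :
    framePt Z x y ∈ Metric.sphere (Z 2) (d 2) ↔ 3 * x ^ 2 + (y - 3) ^ 2 = E ^ 2 := by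
  rw [Metric.mem_sphere, ← framePt_zero_three Z, h.d_two, h.dist_eq_iff h.E_pos.le]
  simp

theorem mem_region001_iff (h : IsEquilateral Z d b D E) {x y : ℝ} :
    framePt Z x y ∈ region001 Z d ↔ 3 * x ^ 2 + (y - 3) ^ 2 ≤ E ^ 2 ∧
      D ^ 2 ≤ 3 * (x + 1) ^ 2 + y ^ 2 ∧ D ^ 2 ≤ 3 * (x - 1) ^ 2 + y ^ 2 := by
  rw [region001, Set.mem_sdiff, Set.mem_union, not_or, Metric.mem_closedBall, Metric.mem_ball,
    Metric.mem_ball, ← framePt_neg_one_zero Z, ← framePt_one_zero Z, ← framePt_zero_three Z,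
    h.d_zero, h.d_one, h.d_two]
  rw [h.dist_le_iff h.E_pos.le, h.dist_lt_iff h.D_pos.le, h.dist_lt_iff h.D_pos.le]
  simp

theorem isN3_framePt (h : IsEquilateral Z d b D E) (hE : E ≤ 6)
    (hD : D ^ 2 ≤ 3 + (3 - E) ^ 2) : IsN3 Z d (framePt Z 0 (3 - E)) := by
  constructor
  · rw [h.mem_region001_iff]
    refine ⟨le_of_eq (by ring), by linarith, by linarith⟩
  · intro Q hQ hne
    obtain ⟨x, y, rfl⟩ := h.surj Q
    rw [h.mem_region001_iff] at hQ
    rw [← framePt_zero_neg_three Z, h.dist_lt_dist_iff]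
    have hy : 3 - E ≤ y := by
      have : -E ≤ y - 3 := (abs_le_of_sq_le_sq' (by nlinarith [sq_nonneg x]) h.E_pos.le).1
      linarith
    rcases hy.eq_or_lt with rfl | hlt
    · have hx : x ≠ 0 := by
        rintro rfl
        exact hne rfl
      have : 0 < x ^ 2 := by positivity
      linarith
    · nlinarith [sq_nonneg x]

theorem isSPlus_zero_one (h : IsEquilateral Z d b D E) {H : ℝ} (hH : 0 ≤ H)
    (hD : D ^ 2 = H ^ 2 + 3) : IsSPlus Z d 0 1 2 (framePt Z 0 H) := by
  constructor
  · exact ⟨h.mem_sphere_zero_iff.2 (by linarith), h.mem_sphere_one_iff.2 (by linarith)⟩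
  · rintro Q ⟨hQ₁, hQ₂⟩ hne
    obtain ⟨x, y, rfl⟩ := h.surj Q
    rw [h.mem_sphere_zero_iff] at hQ₁
    rw [h.mem_sphere_one_iff] at hQ₂
    rw [← framePt_zero_three Z, h.dist_lt_dist_iff]
    obtain rfl : x = 0 := by linarith
    rcases sq_eq_sq_iff_eq_or_eq_neg.1 (show y ^ 2 = H ^ 2 by linarith) with rfl | rfl
    · exact absurd rfl hne
    · have : H ≠ 0 := by
        rintro rfl
        simp at hne
      have : 0 < H := hH.lt_of_ne' this
      linarith

theorem isSMinus_zero_one (h : IsEquilateral Z d b D E) {H : ℝ} (hH : 0 ≤ H)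
    (hD : D ^ 2 = H ^ 2 + 3) : IsSMinus Z d 0 1 2 (framePt Z 0 (-H)) := by
  constructor
  · exact ⟨h.mem_sphere_zero_iff.2 (by linarith), h.mem_sphere_one_iff.2 (by linarith)⟩
  · rintro Q ⟨hQ₁, hQ₂⟩ hne
    obtain ⟨x, y, rfl⟩ := h.surj Q
    rw [h.mem_sphere_zero_iff] at hQ₁
    rw [h.mem_sphere_one_iff] at hQ₂
    rw [← framePt_zero_three Z, h.dist_lt_dist_iff]
    obtain rfl : x = 0 := by linarith
    rcases sq_eq_sq_iff_eq_or_eq_neg.1 (show y ^ 2 = H ^ 2 by linarith) with rfl | rfl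
    · have : y ≠ 0 := by
        rintro rfl
        simp at hne
      have : 0 < y := hH.lt_of_ne' this
      linarith
    · exact absurd rfl hne

/-- `S_23+`, where `2 w` is its power with respect to the first circle, up to sign and the
unit `3 b²`. -/
theorem isSPlus_one_two (h : IsEquilateral Z d b D E) {T w : ℝ} (hT : T < 3) (hw : 0 ≤ w)
    (hE : E ^ 2 = D ^ 2 + 6 - 6 * T) (hwT : w ^ 2 + (3 - T) * w = D ^ 2 - 3 - T ^ 2) :
    IsSPlus Z d 1 2 0 (framePt Z (-(w / 2)) (T - w / 2)) := by
  constructor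
  · exact ⟨h.mem_sphere_one_iff.2 (by linarith), h.mem_sphere_two_iff.2 (by linarith)⟩
  · rintro Q ⟨hQ₁, hQ₂⟩ hne
    obtain ⟨x, y, rfl⟩ := h.surj Q
    rw [h.mem_sphere_one_iff] at hQ₁
    rw [h.mem_sphere_two_iff] at hQ₂
    rw [← framePt_neg_one_zero Z, h.dist_lt_dist_iff]
    obtain rfl : y = x + T := by linarith
    have hx : x + w / 2 ≠ 0 := by
      intro hx
      obtain rfl : x = -(w / 2) := by linarith
      exact hne (by congr 1; ring)
    have : (x + w / 2) * (x - (3 - T + w) / 2) = 0 := by linarith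
    have := (mul_eq_zero.1 this).resolve_left hx
    linarith

theorem isSPlus_two_zero (h : IsEquilateral Z d b D E) {T w : ℝ} (hT : T < 3) (hw : 0 ≤ w)
    (hE : E ^ 2 = D ^ 2 + 6 - 6 * T) (hwT : w ^ 2 + (3 - T) * w = D ^ 2 - 3 - T ^ 2) :
    IsSPlus Z d 2 0 1 (framePt Z (w / 2) (T - w / 2)) := by
  constructor
  · exact ⟨h.mem_sphere_two_iff.2 (by linarith), h.mem_sphere_zero_iff.2 (by linarith)⟩
  · rintro Q ⟨hQ₁, hQ₂⟩ hne
    obtain ⟨x, y, rfl⟩ := h.surj Q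
    rw [h.mem_sphere_two_iff] at hQ₁
    rw [h.mem_sphere_zero_iff] at hQ₂
    rw [← framePt_one_zero Z, h.dist_lt_dist_iff]
    obtain rfl : y = T - x := by linarith
    have hx : x - w / 2 ≠ 0 := by
      intro hx
      obtain rfl : x = w / 2 := by linarith
      exact hne rfl
    have : (x - w / 2) * (x + (3 - T + w) / 2) = 0 := by linarith
    have := (mul_eq_zero.1 this).resolve_left hx
    linarith

end IsEquilateral

theorem cost_eq {D E T u x y : ℝ} (hu : 3 * u = 3 * x ^ 2 + y ^ 2 - (D ^ 2 - 3))
    (hE : E ^ 2 = D ^ 2 + 6 - 6 * T) :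
    cost D E x y = 3 * (|u + 2 * x| + |u - 2 * x| + |u + 2 * (T - y)|) := by
  have e₁ : 3 * (x + 1) ^ 2 + y ^ 2 - D ^ 2 = 3 * (u + 2 * x) := by linarith
  have e₂ : 3 * (x - 1) ^ 2 + y ^ 2 - D ^ 2 = 3 * (u - 2 * x) := by linarith
  have e₃ : 3 * x ^ 2 + (y - 3) ^ 2 - E ^ 2 = 3 * (u + 2 * (T - y)) := by linarith
  rw [cost, e₁, e₂, e₃, abs_mul, abs_mul, abs_mul, abs_of_pos (three_pos : (0 : ℝ) < 3)]
  ring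

theorem cost_zero_left (D E y : ℝ) :
    cost D E 0 y = 2 * |y ^ 2 + 3 - D ^ 2| + |(y - 3) ^ 2 - E ^ 2| := by
  have e₁ : 3 * (0 + 1) ^ 2 + y ^ 2 - D ^ 2 = y ^ 2 + 3 - D ^ 2 := by ring
  have e₂ : 3 * (0 - 1) ^ 2 + y ^ 2 - D ^ 2 = y ^ 2 + 3 - D ^ 2 := by ring
  have e₃ : 3 * 0 ^ 2 + (y - 3) ^ 2 - E ^ 2 = (y - 3) ^ 2 - E ^ 2 := by ring
  rw [cost, e₁, e₂, e₃]
  ring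

theorem cost_neg_left (D E x y : ℝ) : cost D E (-x) y = cost D E x y := by
  rw [cost, cost, add_comm |3 * (x + 1) ^ 2 + y ^ 2 - D ^ 2|]
  congr 1
  · congr 2 <;> ring
  · congr 1; ring

theorem cost_pair {D E T w : ℝ} (hw : 0 ≤ w) (hE : E ^ 2 = D ^ 2 + 6 - 6 * T)
    (hwT : w ^ 2 + (3 - T) * w = D ^ 2 - 3 - T ^ 2) :
    cost D E (w / 2) (T - w / 2) = 6 * w := by
  rw [cost_eq (u := -w) (by linarith) hE]
  have e₁ : -w + 2 * (w / 2) = 0 := by ring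
  have e₂ : -w - 2 * (w / 2) = -(2 * w) := by ring
  have e₃ : -w + 2 * (T - (T - w / 2)) = 0 := by ring
  rw [e₁, e₂, e₃, abs_neg, abs_of_nonneg (by positivity : 0 ≤ 2 * w), abs_zero]
  ring

theorem exists_pair_parameter {K T : ℝ} (hK : T ^ 2 ≤ K) :
    ∃ w, 0 ≤ w ∧ w ^ 2 + (3 - T) * w = K - T ^ 2 := by
  have h : 0 ≤ (3 - T) ^ 2 + 4 * (K - T ^ 2) := by nlinarith [sq_nonneg (3 - T)]
  refine ⟨(√((3 - T) ^ 2 + 4 * (K - T ^ 2)) - (3 - T)) / 2, ?_, ?_⟩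
  · have : 3 - T ≤ √((3 - T) ^ 2 + 4 * (K - T ^ 2)) := Real.le_sqrt_of_sq_le (by linarith)
    linarith
  · have := Real.sq_sqrt h
    linarith

theorem pair_of_cost_le {D E T w x y : ℝ} (hE : E ^ 2 = D ^ 2 + 6 - 6 * T)
    (hwT : w ^ 2 + (3 - T) * w = D ^ 2 - 3 - T ^ 2) (hT₁ : -3 ≤ T) (hT₂ : T ≤ 1)
    (h : cost D E x y ≤ 6 * w) :
    (x = -(w / 2) ∧ y = T - w / 2) ∨ (x = w / 2 ∧ y = T - w / 2) ∨
      (T = 1 ∧ x = 0 ∧ y = T + w) ∨ (T = -3 ∧ x = 0 ∧ y = T - w) := by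
  have hu : 3 * (x ^ 2 + (y ^ 2 - (D ^ 2 - 3)) / 3) = 3 * x ^ 2 + y ^ 2 - (D ^ 2 - 3) := by ring
  rw [cost_eq hu hE] at h
  rcases pair_of_le hu hwT hT₁ hT₂ (by linarith) with ⟨hx, hy⟩ | h | h
  · rcases sq_eq_sq_iff_eq_or_eq_neg.1 (show x ^ 2 = (w / 2) ^ 2 by linarith) with hx | hx
    · exact Or.inr (Or.inl ⟨hx, hy⟩)
    · exact Or.inl ⟨hx, hy⟩
  · exact Or.inr (Or.inr (Or.inl h))
  · exact Or.inr (Or.inr (Or.inr h))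

namespace IsEquilateral

variable {Z : Fin 3 → Plane} {d : Fin 3 → ℝ} {b D E : ℝ}

theorem sources_eq_of_stationary (h : IsEquilateral Z d b D E) {l k y₀ : ℝ} (hl₁ : -1 ≤ l)
    (hl₂ : l ≤ 1) (hk₁ : -1 ≤ k) (hk₂ : k ≤ 1) (hpos : 0 < 2 * l + k)
    (hstat : 2 * l * y₀ + k * (y₀ - 3) = 0)
    (hD : |y₀ ^ 2 + 3 - D ^ 2| = l * (y₀ ^ 2 + 3 - D ^ 2))
    (hE : |(y₀ - 3) ^ 2 - E ^ 2| = k * ((y₀ - 3) ^ 2 - E ^ 2)) :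
    sources Z d = {framePt Z 0 y₀} := by
  refine h.sources_eq_singleton fun x y hxy =>
    eq_of_cost_le_of_stationary hl₁ hl₂ hk₁ hk₂ hpos hstat rfl (hxy.trans (le_of_eq ?_))
  rw [cost_zero_left, hD, hE]
  ring

theorem solY0 (h : IsEquilateral Z d b D E) (hD : D ≤ 2) (hE : E ≤ 2) : SolY0 Z d := by
  have hD₀ := h.D_pos
  have hE₀ := h.E_pos
  rw [SolY0, ← framePt_zero_one]
  apply h.sources_eq_of_stationary (l := 1) (k := 1) <;> try norm_num
  · nlinarith
  · nlinarith

theorem solY3 (h : IsEquilateral Z d b D E) (hD : D ^ 2 ≤ 12) (hE : 6 ≤ E) : SolY3 Z d := by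
  rw [SolY3, ← framePt_zero_neg_three]
  apply h.sources_eq_of_stationary (l := 1) (k := -1) <;> try norm_num
  · linarith
  · rw [abs_of_nonpos (by nlinarith)]
    ring

theorem solN3 (h : IsEquilateral Z d b D E) (hE₁ : 2 ≤ E) (hE₂ : E ≤ 6)
    (hD : D ^ 2 ≤ 3 + (3 - E) ^ 2) : SolN3 Z d := by
  have hE₀ := h.E_pos
  refine ⟨_, h.isN3_framePt hE₂ hD, ?_⟩
  apply h.sources_eq_of_stationary (l := 1) (k := 2 * (3 - E) / E) (by norm_num) le_rfl
  · rw [le_div_iff₀ hE₀]; linarith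
  · rw [div_le_one hE₀]; linarith
  · have : 2 * 1 + 2 * (3 - E) / E = 6 / E := by field_simp; ring
    rw [this]; positivity
  · field_simp; ring
  · rw [abs_of_nonneg (by linarith)]; ring
  · have : (3 - E - 3) ^ 2 - E ^ 2 = 0 := by ring
    rw [this]; simp

theorem solS12p (h : IsEquilateral Z d b D E) {H T : ℝ} (hH : 1 ≤ H) (hD : D ^ 2 = H ^ 2 + 3)
    (hE : E ^ 2 = D ^ 2 + 6 - 6 * T) (hT : 1 < T) : SolS12p Z d := by
  refine ⟨_, h.isSPlus_zero_one (by linarith) hD, ?_⟩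
  have hH₀ : 0 < H := by linarith
  have hD₀ : H ^ 2 + 3 - D ^ 2 = 0 := by linarith
  have hE₀ : (H - 3) ^ 2 - E ^ 2 = 6 * (T - H) := by linarith
  rcases le_or_gt H T with hHT | hHT
  · apply h.sources_eq_of_stationary (l := (3 - H) / (2 * H)) (k := 1)
    · rw [le_div_iff₀ (by positivity)]; linarith
    · rw [div_le_one (by positivity)]; linarith
    · norm_num
    · norm_num
    · have : 2 * ((3 - H) / (2 * H)) + 1 = 3 / H := by field_simp; ring
      rw [this]; positivity
    · field_simp; ring
    · rw [hD₀]; simp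
    · rw [hE₀, abs_of_nonneg (by linarith)]; ring
  · refine h.sources_eq_singleton fun x y hxy => ?_
    have hu : 3 * (x ^ 2 + (y ^ 2 - (D ^ 2 - 3)) / 3) = 3 * x ^ 2 + y ^ 2 - (D ^ 2 - 3) := by ring
    rw [cost_zero_left, hD₀, hE₀, cost_eq hu hE, abs_zero, abs_of_neg (by linarith : 6 * (T - H) < 0)] at hxy
    rw [show D ^ 2 - 3 = H ^ 2 by linarith] at hu hxy
    exact top_of_le hu hT hHT (by linarith)

theorem solS12m (h : IsEquilateral Z d b D E) {H T : ℝ} (hH : 3 ≤ H) (hD : D ^ 2 = H ^ 2 + 3)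
    (hE : E ^ 2 = D ^ 2 + 6 - 6 * T) (hT : T < -3) : SolS12m Z d := by
  refine ⟨_, h.isSMinus_zero_one (by linarith) hD, ?_⟩
  have hH₀ : 0 < H := by linarith
  have hD₀ : (-H) ^ 2 + 3 - D ^ 2 = 0 := by linarith
  have hE₀ : (-H - 3) ^ 2 - E ^ 2 = 6 * (H + T) := by linarith
  rcases le_or_gt T (-H) with hHT | hHT
  · apply h.sources_eq_of_stationary (l := (3 + H) / (2 * H)) (k := -1)
    · rw [le_div_iff₀ (by positivity)]; linarith
    · rw [div_le_one (by positivity)]; linarith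
    · norm_num
    · norm_num
    · have : 2 * ((3 + H) / (2 * H)) + -1 = 3 / H := by field_simp; ring
      rw [this]; positivity
    · field_simp; ring
    · rw [hD₀]; simp
    · rw [hE₀, abs_of_nonpos (by linarith)]; ring
  · refine h.sources_eq_singleton fun x y hxy => ?_
    have hu : 3 * (x ^ 2 + (y ^ 2 - (D ^ 2 - 3)) / 3) = 3 * x ^ 2 + y ^ 2 - (D ^ 2 - 3) := by ring
    rw [cost_zero_left, hD₀, hE₀, cost_eq hu hE, abs_zero, abs_of_pos (by linarith : 0 < 6 * (H + T))] at hxy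
    rw [show D ^ 2 - 3 = H ^ 2 by linarith] at hu hxy
    exact bottom_of_le hu hT hHT (by linarith)

theorem solS23pS31p (h : IsEquilateral Z d b D E) {T : ℝ} (hD : T ^ 2 ≤ D ^ 2 - 3)
    (hE : E ^ 2 = D ^ 2 + 6 - 6 * T) (hT₁ : -3 < T) (hT₂ : T < 1) : SolS23pS31p Z d := by
  obtain ⟨w, hw, hwT⟩ := exists_pair_parameter hD
  refine ⟨_, _, h.isSPlus_one_two (by linarith) hw hE hwT,
    h.isSPlus_two_zero (by linarith) hw hE hwT, ?_⟩
  rw [h.sources_eq (s := {(-(w / 2), T - w / 2), (w / 2, T - w / 2)}) (c := 6 * w)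
    (Set.insert_nonempty _ _), Set.image_pair]
  · rintro p (rfl | rfl)
    · exact (cost_neg_left _ _ _ _).trans (cost_pair hw hE hwT)
    · exact cost_pair hw hE hwT
  · intro x y hxy
    rcases pair_of_cost_le hE hwT hT₁.le hT₂.le hxy with ⟨rfl, rfl⟩ | ⟨rfl, rfl⟩ | h | h
    · simp
    · simp
    · linarith [h.1]
    · linarith [h.1]

theorem solS123p (h : IsEquilateral Z d b D E) {H : ℝ} (hH : 1 ≤ H) (hD : D ^ 2 = H ^ 2 + 3)
    (hE : E = D) : SolS123p Z d := by
  have hw : 0 ≤ H - 1 := by linarith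
  have hwT : (H - 1) ^ 2 + (3 - 1) * (H - 1) = D ^ 2 - 3 - 1 ^ 2 := by linarith
  have hE' : E ^ 2 = D ^ 2 + 6 - 6 * 1 := by rw [hE]; ring
  refine ⟨_, _, _, h.isSPlus_zero_one (by linarith) hD, h.isSPlus_one_two (by norm_num) hw hE' hwT,
    h.isSPlus_two_zero (by norm_num) hw hE' hwT, ?_⟩
  rw [h.sources_eq (s := {(0, H), (-((H - 1) / 2), 1 - (H - 1) / 2),
    ((H - 1) / 2, 1 - (H - 1) / 2)}) (c := 6 * (H - 1)) (Set.insert_nonempty _ _),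
    Set.image_insert_eq, Set.image_pair]
  · rintro p (rfl | rfl | rfl)
    · have e₁ : H ^ 2 + 3 - D ^ 2 = 0 := by linarith
      have e₂ : (H - 3) ^ 2 - E ^ 2 = -(6 * (H - 1)) := by linarith
      rw [cost_zero_left, e₁, e₂, abs_neg, abs_zero, abs_of_nonneg (by linarith)]
      ring
    · exact (cost_neg_left _ _ _ _).trans (cost_pair hw hE' hwT)
    · exact cost_pair hw hE' hwT
  · intro x y hxy
    rcases pair_of_cost_le hE' hwT (by norm_num) le_rfl hxy with
      ⟨rfl, rfl⟩ | ⟨rfl, rfl⟩ | ⟨-, rfl, rfl⟩ | ⟨h, -⟩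
    · simp
    · simp
    · simp
    · norm_num at h

theorem solS23pS31pS12m (h : IsEquilateral Z d b D E) {H : ℝ} (hH : 3 ≤ H)
    (hD : D ^ 2 = H ^ 2 + 3) (hE : E ^ 2 = D ^ 2 + 24) : SolS23pS31pS12m Z d := by
  have hw : 0 ≤ H - 3 := by linarith
  have hwT : (H - 3) ^ 2 + (3 - (-3)) * (H - 3) = D ^ 2 - 3 - (-3) ^ 2 := by linarith
  have hE' : E ^ 2 = D ^ 2 + 6 - 6 * (-3) := by linarith
  refine ⟨_, _, _, h.isSPlus_one_two (by norm_num) hw hE' hwT,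
    h.isSPlus_two_zero (by norm_num) hw hE' hwT, h.isSMinus_zero_one (by linarith) hD, ?_⟩
  rw [h.sources_eq (s := {(-((H - 3) / 2), -3 - (H - 3) / 2),
    ((H - 3) / 2, -3 - (H - 3) / 2), (0, -H)}) (c := 6 * (H - 3)) (Set.insert_nonempty _ _),
    Set.image_insert_eq, Set.image_pair]
  · rintro p (rfl | rfl | rfl)
    · exact (cost_neg_left _ _ _ _).trans (cost_pair hw hE' hwT)
    · exact cost_pair hw hE' hwT
    · have e₁ : (-H) ^ 2 + 3 - D ^ 2 = 0 := by linarith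
      have e₂ : (-H - 3) ^ 2 - E ^ 2 = 6 * (H - 3) := by linarith
      rw [cost_zero_left, e₁, e₂, abs_zero, abs_of_nonneg (by linarith)]
      ring
  · intro x y hxy
    rcases pair_of_cost_le hE' hwT le_rfl (by norm_num) hxy with
      ⟨rfl, rfl⟩ | ⟨rfl, rfl⟩ | ⟨h, -⟩ | ⟨-, rfl, rfl⟩
    · simp
    · simp
    · norm_num at h
    · rw [show -3 - (H - 3) = -H by ring]; simp

end IsEquilateral

theorem isEquilateral_of_dist {Z : Fin 3 → Plane} {d : Fin 3 → ℝ} {b D E : ℝ} (hb : 0 < b)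
    (h12 : dist (Z 0) (Z 1) = 2 * √3 * b) (h23 : dist (Z 1) (Z 2) = 2 * √3 * b)
    (h31 : dist (Z 2) (Z 0) = 2 * √3 * b) (hd : d 0 = d 1) (hD : d 0 = b * D) (hE : d 2 = b * E)
    (hD₀ : 0 < D) (hE₀ : 0 < E) : IsEquilateral Z d b D E := by
  have hr : (2 * √3 * b) ^ 2 = 12 * b ^ 2 := by
    rw [mul_pow, mul_pow, Real.sq_sqrt (by norm_num)]; ring
  rw [← pow_left_inj₀ dist_nonneg (by positivity) two_ne_zero, hr] at h12 h23 h31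
  exact ⟨hb, hD₀, hE₀, hD, hd ▸ hD, hE, dist_sq_framePt h12 h23 h31,
    exists_eq_framePt hb h12 h23 h31⟩

end SourceLoc

theorem mainTheorem6 (Z : Fin 3 → SourceLoc.Plane) (d : Fin 3 → ℝ) (r : ℝ)
    (hr : 0 < r)
    (h12 : dist (Z 0) (Z 1) = r) (h23 : dist (Z 1) (Z 2) = r) (h31 : dist (Z 2) (Z 0) = r)
    (hd : d 0 = d 1) :
    (d 0 ∈ Set.Ioc 0 (r / √3) → d 2 ∈ Set.Ioc 0 (r / √3) → SourceLoc.SolY0 Z d) ∧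
    (d 0 ∈ Set.Ioc 0 r → d 2 ∈ Set.Ici (√3 * r) → SourceLoc.SolY3 Z d) ∧
    (d 0 ∈ Set.Ioc 0 (r / 2) → d 2 ∈ Set.Icc (r / √3) (√3 * r) → SourceLoc.SolN3 Z d) ∧
    (d 0 ∈ Set.Ioc (r / 2) (r / √3) →
      d 2 ∈ Set.Icc (r / √3) (√3 / 2 * r - √(d 0 ^ 2 - r ^ 2 / 4)) → SourceLoc.SolN3 Z d) ∧
    (d 0 ∈ Set.Ioc (r / 2) r →
      d 2 ∈ Set.Icc (√3 / 2 * r + √(d 0 ^ 2 - r ^ 2 / 4)) (√3 * r) → SourceLoc.SolN3 Z d) ∧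
    (d 0 ∈ Set.Ioo (r / 2) (r / √3) →
      d 2 ∈ Set.Ioo (√3 / 2 * r - √(d 0 ^ 2 - r ^ 2 / 4))
        (√3 / 2 * r + √(d 0 ^ 2 - r ^ 2 / 4)) → SourceLoc.SolS23pS31p Z d) ∧
    (d 0 ∈ Set.Ici (r / √3) → d 2 ∈ Set.Ioo 0 (d 0) → SourceLoc.SolS12p Z d) ∧
    (d 0 ∈ Set.Ici (r / √3) → d 2 = d 0 → SourceLoc.SolS123p Z d) ∧
    (d 0 ∈ Set.Ico (r / √3) r →
      d 2 ∈ Set.Ioo (d 0) (√3 / 2 * r + √(d 0 ^ 2 - r ^ 2 / 4)) →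
      SourceLoc.SolS23pS31p Z d) ∧
    (d 0 ∈ Set.Ici r → d 2 ∈ Set.Ioo (d 0) (√(d 0 ^ 2 + 2 * r ^ 2)) →
      SourceLoc.SolS23pS31p Z d) ∧
    (d 0 ∈ Set.Ici r → d 2 = √(d 0 ^ 2 + 2 * r ^ 2) → SourceLoc.SolS23pS31pS12m Z d) ∧
    (d 0 ∈ Set.Ici r → d 2 ∈ Set.Ioi (√(d 0 ^ 2 + 2 * r ^ 2)) → SourceLoc.SolS12m Z d) := by
  have s₃ : √3 * √3 = (3 : ℝ) := Real.mul_self_sqrt (by norm_num)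
  have s₀ : (0 : ℝ) < √3 := by positivity
  obtain ⟨b, hb, rfl⟩ : ∃ b, 0 < b ∧ r = 2 * √3 * b :=
    ⟨r / (2 * √3), by positivity, by field_simp⟩
  obtain ⟨D, hD⟩ : ∃ D, d 0 = b * D := ⟨d 0 / b, by field_simp⟩
  obtain ⟨E, hE⟩ : ∃ E, d 2 = b * E := ⟨d 2 / b, by field_simp⟩
  have e₁ : 2 * √3 * b / √3 = b * 2 := by field_simp
  have e₂ : √3 * (2 * √3 * b) = b * 6 := by linear_combination 2 * b * s₃
  have e₃ : 2 * √3 * b / 2 = b * √3 := by ring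
  have e₄ : √3 / 2 * (2 * √3 * b) = b * 3 := by linear_combination b * s₃
  have e₅ : √((b * D) ^ 2 - (2 * √3 * b) ^ 2 / 4) = b * √(D ^ 2 - 3) := by
    rw [show (b * D) ^ 2 - (2 * √3 * b) ^ 2 / 4 = b ^ 2 * (D ^ 2 - 3) by
      linear_combination -b ^ 2 * s₃, Real.sqrt_mul (by positivity), Real.sqrt_sq hb.le]
  have e₆ : √((b * D) ^ 2 + 2 * (2 * √3 * b) ^ 2) = b * √(D ^ 2 + 24) := by
    rw [show (b * D) ^ 2 + 2 * (2 * √3 * b) ^ 2 = b ^ 2 * (D ^ 2 + 24) by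
      linear_combination 8 * b ^ 2 * s₃, Real.sqrt_mul (by positivity), Real.sqrt_sq hb.le]
  have e₇ : 2 * √3 * b = b * (2 * √3) := by ring
  have h := fun hD₀ hE₀ => SourceLoc.isEquilateral_of_dist hb h12 h23 h31 hd hD hE hD₀ hE₀
  rw [hD, hE, e₁, e₂, e₃, e₄, e₅, e₆, e₇]
  simp only [Set.mem_Ioc, Set.mem_Ioo, Set.mem_Ici, Set.mem_Icc, Set.mem_Ico, Set.mem_Ioi,
    ← mul_add, ← mul_sub, mul_pos_iff_of_pos_left hb, mul_le_mul_iff_right₀ hb,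
    mul_lt_mul_iff_right₀ hb, mul_right_inj' hb.ne']
  obtain ⟨T, hT⟩ : ∃ T, E ^ 2 = D ^ 2 + 6 - 6 * T := ⟨(D ^ 2 + 6 - E ^ 2) / 6, by ring⟩
  obtain ⟨H, hHD⟩ : ∃ H, H = √(D ^ 2 - 3) := ⟨_, rfl⟩
  obtain ⟨F, hFD⟩ : ∃ F, F = √(D ^ 2 + 24) := ⟨_, rfl⟩
  rw [← hHD, ← hFD]
  have hH₀ : 0 ≤ H := hHD ▸ Real.sqrt_nonneg _
  have hF₀ : 0 < F := hFD ▸ Real.sqrt_pos.2 (by positivity)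
  have hF : F ^ 2 = D ^ 2 + 24 := by rw [hFD, Real.sq_sqrt (by positivity)]
  have hH : √3 ≤ D → D ^ 2 = H ^ 2 + 3 := fun hD' => by
    have := pow_le_pow_left₀ s₀.le hD' 2
    rw [hHD, Real.sq_sqrt (by linarith)]; ring
  have s₂ : √3 ≤ 2 := Real.sqrt_le_iff.2 (by norm_num)
  have sq_lt : ∀ {p q : ℝ}, 0 ≤ p → p < q → p ^ 2 < q ^ 2 :=
    fun hp hpq => pow_lt_pow_left₀ hpq hp two_ne_zero
  have sq_le : ∀ {p q : ℝ}, 0 ≤ p → p ≤ q → p ^ 2 ≤ q ^ 2 :=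
    fun hp hpq => pow_le_pow_left₀ hp hpq 2
  have hH₁ : 2 ≤ D → 1 ≤ H := fun hD' => by
    have := hH (by linarith)
    have := sq_le two_pos.le hD'
    exact le_of_sq_le_sq (by linarith) hH₀
  have hH₃ : 2 * √3 ≤ D → 3 ≤ H := fun hD' => by
    have := hH (by linarith)
    have := sq_le (by positivity) hD'
    exact le_of_sq_le_sq (by linarith) hH₀
  refine ⟨?_, ?_, ?_, ?_, ?_, ?_, ?_, ?_, ?_, ?_, ?_, ?_⟩
  · rintro ⟨a₁, a₂⟩ ⟨a₃, a₄⟩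
    exact (h a₁ a₃).solY0 a₂ a₄
  · rintro ⟨a₁, a₂⟩ a₃
    have := sq_le a₁.le a₂
    exact (h a₁ (by linarith)).solY3 (by linarith) a₃
  · rintro ⟨a₁, a₂⟩ ⟨a₃, a₄⟩
    have := sq_le a₁.le a₂
    exact (h a₁ (by linarith)).solN3 a₃ a₄ (by linarith [sq_nonneg (3 - E)])
  · rintro ⟨a₁, a₂⟩ ⟨a₃, a₄⟩
    have := sq_le hH₀ (show H ≤ 3 - E by linarith)
    exact (h (by linarith) (by linarith)).solN3 a₃ (by linarith) (by linarith [hH a₁.le])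
  · rintro ⟨a₁, a₂⟩ ⟨a₃, a₄⟩
    have := sq_le hH₀ (show H ≤ E - 3 by linarith)
    exact (h (by linarith) (by linarith)).solN3 (by linarith) a₄ (by linarith [hH a₁.le])
  · rintro ⟨a₁, a₂⟩ ⟨a₃, a₄⟩
    have hD' := hH a₁.le
    have hH' : H < 1 := by
      have := sq_lt (by linarith) a₂
      exact lt_of_pow_lt_pow_left₀ 2 zero_le_one (by linarith)
    have := sq_lt (by linarith) a₃
    have := sq_lt (by linarith) a₄
    exact (h (by linarith) (by linarith)).solS23pS31p
      ((sq_le_sq' (by linarith) (by linarith)).trans_eq (eq_sub_of_add_eq hD'.symm)) hT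
      (by linarith) (by linarith)
  · rintro a₁ ⟨a₂, a₃⟩
    have := sq_lt a₂.le a₃
    exact (h (by linarith) a₂).solS12p (hH₁ a₁) (hH (by linarith)) hT (by linarith)
  · rintro a₁ a₂
    exact (h (by linarith) (by linarith)).solS123p (hH₁ a₁) (hH (by linarith)) a₂
  · rintro ⟨a₁, a₂⟩ ⟨a₃, a₄⟩
    have hD' := hH (by linarith)
    have hH' := hH₁ a₁
    have hH'' : H < 3 := by
      have := sq_lt (by linarith) a₂
      exact lt_of_pow_lt_pow_left₀ 2 three_pos.le (by linarith)
    have := sq_lt (by linarith) a₃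
    have := sq_lt (by linarith) a₄
    exact (h (by linarith) (by linarith)).solS23pS31p
      ((sq_le_sq' (by linarith) (by linarith)).trans_eq (eq_sub_of_add_eq hD'.symm)) hT
      (by linarith) (by linarith)
  · rintro a₁ ⟨a₂, a₃⟩
    have hD' := hH (by linarith)
    have hH' := hH₃ a₁
    have := sq_lt (by linarith) a₂
    have := sq_lt (by linarith) a₃
    exact (h (by linarith) (by linarith)).solS23pS31p
      ((sq_le_sq' (by linarith) (by linarith)).trans_eq (eq_sub_of_add_eq hD'.symm)) hT
      (by linarith) (by linarith)
  · rintro a₁ rfl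
    exact (h (by linarith) hF₀).solS23pS31pS12m (hH₃ a₁) (hH (by linarith)) hF
  · rintro a₁ a₂
    have := sq_lt hF₀.le a₂
    exact (h (by linarith) (by linarith)).solS12m (hH₃ a₁) (hH (by linarith)) hT (by linarith)
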